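/- Given a family $\mathcal F$ of finite graphs, the $\mathcal F$-saturation game on $n$ vertices is played by two players, Max and Mini. Starting with Max, they alternately add an edge to an initially empty graph on $n$ vertices, subject to the sole constraint that the graph never contains a (not necessarily induced) subgraph isomorphic to a member of $\mathcal F$. The game ends when no further edge can be added. Max wants the final graph to have as many edges as possible and Mini as few as possible; $\mathrm{sat}_g(n,\mathcal F)$ denotes the number of edges of the final graph when both players play optimally. Let $C_\ell$ denote the cycle of length $\ell$. Theorem. Let $\mathcal C$ be a (finite or infinite) family of cycles $C_\ell$, $\ell\ge 3$, with $C_3\notin\mathcal C$, and suppose that there is an integer $k\ge 3$ such that for every integer $\ell\ge k$ at least one of $C_\ell$, $C_{\ell+1}$ lies in $\mathcal C$. Then for every integer $n\ge 1$, $$\mathrm{sat}_g(n,\mathcal C)\le \tfrac12(3k-1)(n-1).$$ -/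

import Mathlib

/-- Finite graphs, with vertex set `Fin m` for some `m`. -/
abbrev FinGraph : Type := Σ m : ℕ, SimpleGraph (Fin m)

/-- The cycle `C_ℓ` on `ℓ` vertices (a genuine cycle when `3 ≤ ℓ`). -/
def cyc (ℓ : ℕ) : FinGraph := ⟨ℓ, SimpleGraph.cycleGraph ℓ⟩

/-- A family of cycles: every member is `C_ℓ` for some `ℓ ≥ 3`. The family may be infinite. -/
def IsCycleFamily (𝓒 : Set FinGraph) : Prop :=
  ∀ F ∈ 𝓒, ∃ ℓ : ℕ, 3 ≤ ℓ ∧ F = cyc ℓ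

/-- `G` has no (not necessarily induced) subgraph isomorphic to a member of `𝓕`. -/
def FamilyFree {V : Type*} (𝓕 : Set FinGraph) (G : SimpleGraph V) : Prop :=
  ∀ F ∈ 𝓕, F.2.Free G

/-- A legal move of the `𝓕`-saturation game: `H` is `G` plus one new edge, and `H` is `𝓕`-free. -/
def LegalMove {V : Type*} (𝓕 : Set FinGraph) (G H : SimpleGraph V) : Prop :=
  ∃ u v : V, u ≠ v ∧ ¬ G.Adj u v ∧ H = G ⊔ SimpleGraph.edge u v ∧ FamilyFree 𝓕 H

theorem LegalMove.lt {V : Type*} {𝓕 : Set FinGraph} {G H : SimpleGraph V}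
    (h : LegalMove 𝓕 G H) : G < H := by
  obtain ⟨u, v, huv, hG, rfl, -⟩ := h
  refine lt_of_le_of_ne le_sup_left fun he => hG ?_
  rw [he]
  simp [SimpleGraph.edge_adj, huv]

/-- The two players: `mx` wants many edges in the final graph, `mini` wants few. -/
inductive Player where
  | mx
  | mini

open Classical in
/-- The number of edges of the final graph of the `𝓕`-saturation game under optimal play, when the
current graph is `G` and the given player moves next. The players alternate, a player with a legal
move has to make one, and the game ends when there is none. (There are finitely many moves, so the
supremum and the infimum of these natural numbers are a maximum and a minimum.) -/
noncomputable def gameValue {V : Type*} [Finite V] (𝓕 : Set FinGraph) (p : Player)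
    (G : SimpleGraph V) : ℕ :=
  if ∃ H, LegalMove 𝓕 G H then
    match p with
    | .mx => ⨆ H : {H : SimpleGraph V // LegalMove 𝓕 G H}, gameValue 𝓕 .mini H.1
    | .mini => ⨅ H : {H : SimpleGraph V // LegalMove 𝓕 G H}, gameValue 𝓕 .mx H.1
  else G.edgeSet.ncard
termination_by (wellFounded_gt : WellFounded ((· > ·) : SimpleGraph V → SimpleGraph V → Prop)).wrap G
decreasing_by
  all_goals exact H.2.lt

/-- The game saturation number `sat_g(n, 𝓕)`: the game starts from the empty graph on `n` vertices,
and Max makes the first move. -/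
noncomputable def satGame (n : ℕ) (𝓕 : Set FinGraph) : ℕ :=
  gameValue 𝓕 Player.mx (⊥ : SimpleGraph (Fin n))

/-!
Suppose that no two cycles of consecutive lengths at least `k` occur in a graph all of whose
nontrivial blocks contain a triangle. A path of length at least `k - 1` joining two vertices of a
triangle and avoiding the third would give two such cycles. Joining a long cycle to the triangle
of its block by two disjoint paths produces such a path, so every cycle is shorter than `3 * k`.
Likewise the neighbors of an end of a longest path are so sparse along the path that there are at
most `(3 * k - 1) / 2` of them. Hence the graph is `(3 * k - 1) / 2`-degenerate, which bounds its
number of edges.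

It remains to see that Mini can keep a triangle in every nontrivial block. A move of Max threatens
this only if it joins the ends of a path of at least three bridges, so Mini also prevents paths of
four bridges. Then a bad move of Max completes three bridges to a four-cycle, which Mini splits by
a chord. Otherwise Mini closes a triangle over two adjacent bridges, the new edge being one of them
if possible, and when no two bridges are adjacent every move is safe. The chord and the closing
edges are legal because every cycle through them is a triangle.
-/

open SimpleGraph

variable {V : Type*} {G H : SimpleGraph V}

section Paths

variable {S T : Set V} {u v w x y a b c d p q : V}

theorem isPath_append {P : G.Walk u v} {Q : G.Walk v w} (hP : P.IsPath) (hQ : Q.IsPath)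
    (h : ∀ z ∈ P.support, z ∈ Q.support → z = v) : (P.append Q).IsPath := by
  have hQ' := hQ.support_nodup
  rw [← Walk.cons_tail_support, List.nodup_cons] at hQ'
  rw [Walk.isPath_def, Walk.support_append, List.nodup_append']
  exact ⟨hP.support_nodup, hQ'.2,
    fun z hz hz' => hQ'.1 (h z hz (List.mem_of_mem_tail hz') ▸ hz')⟩

/-- `A` and `B` are the two internally disjoint arcs into which their common ends divide the
cycle `C`. -/
structure IsArcPair (C : G.Walk u u) (A B : G.Walk p q) : Prop where
  isPath_left : A.IsPath
  isPath_right : B.IsPath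
  eq_or_eq : ∀ z ∈ A.support, z ∈ B.support → z = p ∨ z = q
  mem_support_iff : ∀ z, z ∈ C.support ↔ z ∈ A.support ∨ z ∈ B.support
  mem_edges_iff : ∀ e, e ∈ C.edges ↔ e ∈ A.edges ∨ e ∈ B.edges
  length_add_length : A.length + B.length = C.length

theorem IsArcPair.symm {C : G.Walk u u} {A B : G.Walk p q} (h : IsArcPair C A B) :
    IsArcPair C B A where
  isPath_left := h.isPath_right
  isPath_right := h.isPath_left
  eq_or_eq z hz hz' := h.eq_or_eq z hz' hz
  mem_support_iff z := (h.mem_support_iff z).trans or_comm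
  mem_edges_iff e := (h.mem_edges_iff e).trans or_comm
  length_add_length := (Nat.add_comm ..).trans h.length_add_length

theorem IsArcPair.support_subset {C : G.Walk u u} {A B : G.Walk p q} (h : IsArcPair C A B) :
    A.support ⊆ C.support :=
  fun z hz => (h.mem_support_iff z).2 (.inl hz)

theorem exists_isArcPair {C : G.Walk u u} (hC : C.IsCycle) (hp : p ∈ C.support)
    (hq : q ∈ C.support) (hpq : p ≠ q) : ∃ A B : G.Walk p q, IsArcPair C A B := by
  classical
  obtain ⟨A, B, hAB⟩ :=
    Walk.mem_support_iff_exists_append.1 ((Walk.mem_support_rotate_iff C p hp).2 hq)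
  have hcycle : (A.append B).IsCycle := hAB ▸ (Walk.isCycle_rotate hp).2 hC
  refine ⟨A, B.reverse, ⟨hcycle.isPath_of_append_left fun h => hpq h.eq.symm,
    (hcycle.isPath_of_append_right fun h => hpq h.eq).reverse, fun z hzA hzB => ?_,
    fun z => ?_, fun e => ?_, ?_⟩⟩
  · have hdisj := hcycle.support_nodup
    rw [Walk.tail_support_append, List.nodup_append'] at hdisj
    rw [Walk.support_reverse, List.mem_reverse, Walk.mem_support_iff] at hzB
    rw [Walk.mem_support_iff] at hzA
    have := @hdisj.2.2 z
    tauto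
  · rw [← Walk.mem_support_rotate_iff C p hp, hAB, Walk.mem_support_append_iff,
      Walk.support_reverse, List.mem_reverse]
  · rw [← (C.rotate_edges p hp).mem_iff, hAB, Walk.edges_append, List.mem_append,
      Walk.edges_reverse, List.mem_reverse]
  · rw [← C.length_rotate p hp, hAB, Walk.length_append, Walk.length_reverse]

theorem exists_isPath_of_mem_edges {C : G.Walk u u} (hC : C.IsCycle) (hxy : s(x, y) ∈ C.edges) :
    ∃ R : G.Walk x y, R.IsPath ∧ s(x, y) ∉ R.edges ∧ R.length + 1 = C.length ∧
      C.support ⊆ R.support := by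
  suffices h : ∀ A B : G.Walk x y, IsArcPair C A B → s(x, y) ∈ A.edges →
      ∃ R : G.Walk x y, R.IsPath ∧ s(x, y) ∉ R.edges ∧ R.length + 1 = C.length ∧
        C.support ⊆ R.support by
    obtain ⟨A, B, hAB⟩ := exists_isArcPair hC (C.fst_mem_support_of_mem_edges hxy)
      (C.snd_mem_support_of_mem_edges hxy) (C.adj_of_mem_edges hxy).ne
    exact ((hAB.mem_edges_iff _).1 hxy).elim (h A B hAB) (h B A hAB.symm)
  intro A B hAB hA
  have hlenA := hAB.isPath_left.length_eq_one_of_mem_edges hA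
  have hlen := hAB.length_add_length
  refine ⟨B, hAB.isPath_right, fun hB => ?_, by omega, fun z hz => ?_⟩
  · have := hAB.isPath_right.length_eq_one_of_mem_edges hB
    have := hC.three_le_length
    omega
  · refine ((hAB.mem_support_iff z).1 hz).elim (fun hzA => ?_) id
    rw [hAB.isPath_left.eq_adj_toWalk_of_mem_edges hA] at hzA
    obtain rfl | rfl : z = x ∨ z = y := by simpa using hzA
    exacts [B.start_mem_support, B.end_mem_support]

/-- `P` is an `S`–`T` path: it meets `S` in its first vertex only and `T` in its last vertex
only. -/
structure IsPathFromTo (S T : Set V) (P : G.Walk p q) : Prop where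
  isPath : P.IsPath
  start_mem : p ∈ S
  end_mem : q ∈ T
  eq_start : ∀ z ∈ P.support, z ∈ S → z = p
  eq_end : ∀ z ∈ P.support, z ∈ T → z = q

theorem IsPathFromTo.nil (hS : p ∈ S) (hT : p ∈ T) :
    IsPathFromTo S T (.nil : G.Walk p p) := by
  constructor <;> simp [hS, hT]

theorem IsPathFromTo.isPath_append_append_reverse {P : G.Walk a p} {Q : G.Walk b q}
    {A : G.Walk p q} (hP : IsPathFromTo S T P) (hQ : IsPathFromTo S T Q)
    (hPQ : P.support.Disjoint Q.support) (hA : A.IsPath) (hAT : ∀ z ∈ A.support, z ∈ T) :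
    (P.append (A.append Q.reverse)).IsPath := by
  refine isPath_append hP.isPath (isPath_append hA hQ.isPath.reverse fun z hz hz' => ?_)
    fun z hz hz' => ?_
  · exact hQ.eq_end z (by simpa using hz') (hAT z hz)
  · rw [Walk.mem_support_append_iff, Walk.support_reverse, List.mem_reverse] at hz'
    exact hz'.elim (fun h => hP.eq_end z hz (hAT z h)) fun h => (hPQ hz h).elim

theorem exists_isPathFromTo {R : G.Walk a b} (hR : R.IsPath) (ha : a ∈ S) (hb : b ∈ T) :
    ∃ (p q : V) (P : G.Walk p q), IsPathFromTo S T P ∧ P.support ⊆ R.support := by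
  classical
  obtain ⟨q, hq, hqR, hq_first⟩ := R.exists_mem_support_forall_mem_support_imp_eq
    {z ∈ R.support.toFinset | z ∈ T} ⟨b, by simpa using hb⟩
  obtain ⟨p, hp, hpR, hp_last⟩ :=
    (R.takeUntil q hqR).reverse.exists_mem_support_forall_mem_support_imp_eq
    {z ∈ R.support.toFinset | z ∈ S} ⟨a, by simpa using ha⟩
  simp only [Finset.mem_filter, List.mem_toFinset] at hp hq hp_last hq_first
  set P := ((R.takeUntil q hqR).reverse.takeUntil p hpR).reverse
  have hP_sub : P.support ⊆ (R.takeUntil q hqR).support := fun z hz => by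
    simpa using Walk.support_takeUntil_subset_support _ hpR (by simpa [P] using hz)
  have hP_sub' : P.support ⊆ R.support := fun z hz =>
    Walk.support_takeUntil_subset_support _ hqR (hP_sub hz)
  exact ⟨p, q, P, ⟨(hR.takeUntil hqR).reverse.takeUntil hpR |>.reverse, hp.2, hq.2,
    fun z hz hzS => hp_last z ⟨hP_sub' hz, hzS⟩ (by simpa [P] using hz),
    fun z hz hzT => hq_first z ⟨hP_sub' hz, hzT⟩ (hP_sub hz)⟩, hP_sub'⟩

theorem disjoint_support_of_isPath_append {A : G.Walk u c} {M : G.Walk c d} {B : G.Walk d v}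
    (h : (A.append (M.append B)).IsPath) (hcd : c ≠ d) : A.support.Disjoint B.support := by
  intro z hzA hzB
  by_cases hzc : z = c
  · exact h.of_append_right.ne_of_mem_support_of_append hcd M.start_mem_support (hzc ▸ hzB) rfl
  · exact h.ne_of_mem_support_of_append hzc hzA
      ((Walk.mem_support_append_iff M B).2 (.inr hzB)) rfl

theorem exists_disjoint_isPathFromTo {R : G.Walk x y} (hR : R.IsPath) (hx : x ∈ S) (hy : y ∈ S)
    (hc : c ∈ R.support) (hd : d ∈ R.support) (hcT : c ∈ T) (hdT : d ∈ T) (hcd : c ≠ d) :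
    ∃ (a p b q : V) (P : G.Walk a p) (Q : G.Walk b q),
      IsPathFromTo S T P ∧ IsPathFromTo S T Q ∧ P.support.Disjoint Q.support := by
  suffices h : ∃ (c' d' : V) (A : G.Walk x c') (M : G.Walk c' d') (B : G.Walk d' y),
      c' ∈ T ∧ d' ∈ T ∧ c' ≠ d' ∧ R = A.append (M.append B) by
    obtain ⟨c', d', A, M, B, hc', hd', hne, rfl⟩ := h
    obtain ⟨a, p, P, hP, hP_sub⟩ := exists_isPathFromTo hR.of_append_left hx hc'
    obtain ⟨b, q, Q, hQ, hQ_sub⟩ :=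
      exists_isPathFromTo hR.of_append_right.of_append_right.reverse hy hd'
    exact ⟨a, p, b, q, P, Q, hP, hQ, fun z hzP hzQ =>
      disjoint_support_of_isPath_append hR hne (hP_sub hzP) (by simpa using hQ_sub hzQ)⟩
  obtain ⟨A, B, rfl⟩ := Walk.mem_support_iff_exists_append.1 hc
  rcases (Walk.mem_support_append_iff A B).1 hd with hd | hd
  · obtain ⟨A, M, rfl⟩ := Walk.mem_support_iff_exists_append.1 hd
    exact ⟨d, c, A, M, B, hdT, hcT, hcd.symm, Walk.append_assoc .. |>.symm⟩
  · obtain ⟨M, B, rfl⟩ := Walk.mem_support_iff_exists_append.1 hd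
    exact ⟨c, d, A, M, B, hcT, hdT, hcd, rfl⟩

end Paths

section Blocks

variable {a b c : V} {e f g : Sym2 V}

/-- The edges `e` and `f` lie on a common cycle. On the edges lying on cycles this is an
equivalence relation, whose classes are the edge sets of the blocks of `G`. -/
def CyclicPair (G : SimpleGraph V) (e f : Sym2 V) : Prop :=
  ∃ (u : V) (C : G.Walk u u), C.IsCycle ∧ e ∈ C.edges ∧ f ∈ C.edges

theorem CyclicPair.symm (h : CyclicPair G e f) : CyclicPair G f e := by
  obtain ⟨u, C, hC, he, hf⟩ := h
  exact ⟨u, C, hC, hf, he⟩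

theorem CyclicPair.left (h : CyclicPair G e f) : CyclicPair G e e := by
  obtain ⟨u, C, hC, he, -⟩ := h
  exact ⟨u, C, hC, he, he⟩

theorem CyclicPair.mono (hGH : G ≤ H) (h : CyclicPair G e f) : CyclicPair H e f := by
  obtain ⟨u, C, hC, he, hf⟩ := h
  exact ⟨u, C.mapLe hGH, hC.mapLe hGH, by simpa, by simpa⟩

theorem isCycle_cons_symm {W : G.Walk a b} (hW : W.IsPath) (hab : G.Adj a b)
    (h : s(a, b) ∉ W.edges) : (Walk.cons hab.symm W).IsCycle :=
  (Walk.cons_isCycle_iff W hab.symm).2 ⟨hW, Sym2.eq_swap ▸ h⟩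

theorem cyclicPair_of_isPath {W : G.Walk a b} (hW : W.IsPath) (hab : G.Adj a b)
    (he : e ∈ W.edges) (hne : e ≠ s(a, b)) : CyclicPair G s(a, b) e := by
  refine ⟨b, _, isCycle_cons_symm hW hab fun h => hne ?_, by simp [Sym2.eq_swap], by simp [he]⟩
  rw [hW.eq_adj_toWalk_of_mem_edges h] at he
  simpa using he

theorem cyclicPair_of_triangle (hab : G.Adj a b) (hac : G.Adj a c) (hbc : G.Adj b c) :
    CyclicPair G s(a, b) s(b, c) := by
  have hW : (Walk.cons hac (.cons hbc.symm .nil)).IsPath := by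
    simp [Walk.isPath_def, hab.ne, hac.ne, hbc.ne']
  exact cyclicPair_of_isPath hW hab (by simp [Sym2.eq_swap]) (by simp [hac.ne', hbc.ne'])

theorem CyclicPair.trans (hef : CyclicPair G e f) (hfg : CyclicPair G f g) :
    CyclicPair G e g := by
  by_cases heg : e = g
  · exact heg ▸ hef.left
  obtain ⟨u, C, hC, he, hfC⟩ := hef
  obtain ⟨v, D, hD, hfD, hg⟩ := hfg
  induction f with | h c d =>
  induction g with | h x y =>
  -- Two disjoint paths from the edge `xy` to `C`, the arc of `C` through `e`, and `xy` itself
  -- form a cycle.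
  obtain ⟨R, hR, -, -, hDR⟩ := exists_isPath_of_mem_edges hD hg
  obtain ⟨a, p, b, q, P, Q, hP, hQ, hPQ⟩ :=
    exists_disjoint_isPathFromTo (S := {x, y}) (T := {z | z ∈ C.support}) hR (by simp) (by simp)
      (hDR (D.fst_mem_support_of_mem_edges hfD)) (hDR (D.snd_mem_support_of_mem_edges hfD))
      (C.fst_mem_support_of_mem_edges hfC) (C.snd_mem_support_of_mem_edges hfC)
      (C.adj_of_mem_edges hfC).ne
  have hab : a ≠ b := by rintro rfl; exact hPQ P.start_mem_support Q.start_mem_support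
  have hpq : p ≠ q := by rintro rfl; exact hPQ P.end_mem_support Q.end_mem_support
  have hxy : s(x, y) = s(a, b) := by
    have ha : a = x ∨ a = y := hP.start_mem
    have hb : b = x ∨ b = y := hQ.start_mem
    grind
  obtain ⟨A, hA, hAC, heA⟩ :
      ∃ A : G.Walk p q, A.IsPath ∧ A.support ⊆ C.support ∧ e ∈ A.edges := by
    obtain ⟨A, B, hAB⟩ := exists_isArcPair hC hP.end_mem hQ.end_mem hpq
    rcases (hAB.mem_edges_iff e).1 he with h | h
    exacts [⟨A, hAB.isPath_left, hAB.support_subset, h⟩,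
      ⟨B, hAB.isPath_right, hAB.symm.support_subset, h⟩]
  have hadj : G.Adj a b := by simpa [← mem_edgeSet, ← hxy] using D.edges_subset_edgeSet hg
  have hW := hP.isPath_append_append_reverse hQ hPQ hA fun _ h => hAC h
  exact hxy ▸ (cyclicPair_of_isPath hW hadj (by simp [heA]) (hxy ▸ heg)).symm

/-- The block containing the edge `e` contains a triangle. -/
def BlockHasTriangle (G : SimpleGraph V) (e : Sym2 V) : Prop :=
  ∃ a b c, G.Adj a b ∧ G.Adj a c ∧ G.Adj b c ∧ CyclicPair G e s(a, b)

theorem BlockHasTriangle.mono (hGH : G ≤ H) (h : BlockHasTriangle G e) :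
    BlockHasTriangle H e := by
  obtain ⟨a, b, c, hab, hac, hbc, he⟩ := h
  exact ⟨a, b, c, hGH hab, hGH hac, hGH hbc, he.mono hGH⟩

theorem CyclicPair.blockHasTriangle (hef : CyclicPair G e f) (hf : BlockHasTriangle G f) :
    BlockHasTriangle G e := by
  obtain ⟨a, b, c, hab, hac, hbc, h⟩ := hf
  exact ⟨a, b, c, hab, hac, hbc, hef.trans h⟩

theorem blockHasTriangle_of_triangle (hab : G.Adj a b) (hac : G.Adj a c) (hbc : G.Adj b c) :
    BlockHasTriangle G s(a, b) :=
  ⟨a, b, c, hab, hac, hbc, (cyclicPair_of_triangle hab hac hbc).left⟩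

/-- Every block that is not a single edge contains a triangle. -/
def BlocksHaveTriangle (G : SimpleGraph V) : Prop :=
  ∀ e, CyclicPair G e e → BlockHasTriangle G e

end Blocks

section ConsecutiveCycles

variable {k : ℕ} {u a b c p q : V}

/-- `G` does not contain cycles of two consecutive lengths, both at least `k`. -/
def NoConsecutiveCycles (G : SimpleGraph V) (k : ℕ) : Prop :=
  ∀ ℓ ≥ k, cycleGraph ℓ ⊑ G → (cycleGraph (ℓ + 1)).Free G

theorem NoConsecutiveCycles.of_isContained {W : Type*} {H : SimpleGraph W}
    (hH : NoConsecutiveCycles H k) (hGH : G ⊑ H) : NoConsecutiveCycles G k :=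
  fun ℓ hℓ h h' => hH ℓ hℓ (h.trans hGH) (h'.trans hGH)

theorem cycleGraph_isContained_of_isPath {W : G.Walk a b} (hW : W.IsPath) (hab : G.Adj a b)
    (hlen : 2 ≤ W.length) : cycleGraph (W.length + 1) ⊑ G := by
  refine (cycleGraph_isContained_iff (by omega)).2
    ⟨b, _, isCycle_cons_symm hW hab fun h => ?_, Walk.length_cons ..⟩
  have := hW.length_eq_one_of_mem_edges h
  omega

namespace NoConsecutiveCycles

theorem length_add_one_lt (hG : NoConsecutiveCycles G k) (hk : 3 ≤ k) (hab : G.Adj a b)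
    (hac : G.Adj a c) (hbc : G.Adj b c) {W : G.Walk a b} (hW : W.IsPath) (hc : c ∉ W.support) :
    W.length + 1 < k := by
  by_contra! hlen
  have hW' : (Walk.cons hac.symm W).IsPath := hW.cons hc
  exact hG (W.length + 1) hlen (cycleGraph_isContained_of_isPath hW hab (by omega))
    (cycleGraph_isContained_of_isPath hW' hbc.symm (by rw [Walk.length_cons]; omega))

theorem length_lt_of_triangle_subset (hG : NoConsecutiveCycles G k) (hk : 3 ≤ k)
    {C : G.Walk u u} (hC : C.IsCycle) (hab : G.Adj a b) (hac : G.Adj a c) (hbc : G.Adj b c)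
    (ha : a ∈ C.support) (hb : b ∈ C.support) (hc : c ∈ C.support) : C.length < 3 * k := by
  suffices h : ∀ A B : G.Walk a b, IsArcPair C A B → c ∈ B.support → C.length < 3 * k by
    obtain ⟨A, B, hAB⟩ := exists_isArcPair hC ha hb hab.ne
    exact ((hAB.mem_support_iff c).1 hc).elim (h B A hAB.symm) (h A B hAB)
  intro A B hAB hcB
  have hcA : c ∉ A.support := fun h => (hAB.eq_or_eq c h hcB).elim hac.ne' hbc.ne'
  have hlen := hAB.length_add_length
  have hB := hAB.isPath_right
  obtain ⟨B₁, B₂, hB₁, hB₂, rfl⟩ := hB.mem_support_iff_exists_append.1 hcB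
  have hbB₁ : b ∉ B₁.support := fun h =>
    hB.ne_of_mem_support_of_append hbc.ne h B₂.end_mem_support rfl
  have haB₂ : a ∉ B₂.support := fun h =>
    hB.ne_of_mem_support_of_append hac.ne B₁.start_mem_support h rfl
  have hA_lt := hG.length_add_one_lt hk hab hac hbc hAB.isPath_left hcA
  have hB₁_lt := hG.length_add_one_lt hk hac hab hbc.symm hB₁ hbB₁
  have hB₂_lt := hG.length_add_one_lt hk hbc.symm hac.symm hab.symm hB₂ haB₂
  rw [Walk.length_append] at hlen
  omega

theorem length_lt_of_isPathFromTo (hG : NoConsecutiveCycles G k) (hk : 3 ≤ k) {C : G.Walk u u}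
    (hC : C.IsCycle) {S : Set V} (hS : G.IsClique S) (hcS : c ∈ S) (hca : c ≠ a) (hcb : c ≠ b)
    (hcC : c ∉ C.support) {P : G.Walk a p} {Q : G.Walk b q}
    (hP : IsPathFromTo S {z | z ∈ C.support} P) (hQ : IsPathFromTo S {z | z ∈ C.support} Q)
    (hPQ : P.support.Disjoint Q.support) : C.length < 2 * k := by
  by_contra! hlen
  have hab : a ≠ b := by rintro rfl; exact hPQ P.start_mem_support Q.start_mem_support
  have hpq : p ≠ q := by rintro rfl; exact hPQ P.end_mem_support Q.end_mem_support
  obtain ⟨A, hA, hAC, hkA⟩ : ∃ A : G.Walk p q, A.IsPath ∧ A.support ⊆ C.support ∧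
      k ≤ A.length := by
    obtain ⟨A, B, hAB⟩ := exists_isArcPair hC hP.end_mem hQ.end_mem hpq
    have := hAB.length_add_length
    rcases le_total k A.length with h | h
    exacts [⟨A, hAB.isPath_left, hAB.support_subset, h⟩,
      ⟨B, hAB.isPath_right, hAB.symm.support_subset, by omega⟩]
  have hc : c ∉ (P.append (A.append Q.reverse)).support := by
    simp only [Walk.mem_support_append_iff, Walk.support_reverse, List.mem_reverse, not_or]
    exact ⟨fun h => hca (hP.eq_start c h hcS), fun h => hcC (hAC h),
      fun h => hcb (hQ.eq_start c h hcS)⟩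
  have := hG.length_add_one_lt hk (hS hP.start_mem hQ.start_mem hab)
    (hS hP.start_mem hcS hca.symm) (hS hQ.start_mem hcS hcb.symm)
    (hP.isPath_append_append_reverse hQ hPQ hA fun _ h => hAC h) hc
  simp only [Walk.length_append] at this
  omega

theorem length_lt_of_exists_notMem (hG : NoConsecutiveCycles G k) (hk : 3 ≤ k) {C : G.Walk u u}
    (hC : C.IsCycle) {S : Set V} (hS : G.IsClique S) (hcS : c ∈ S) (hca : c ≠ a) (hcb : c ≠ b)
    (hSC : ∃ w ∈ S, w ∉ C.support) {P : G.Walk a p} {Q : G.Walk b q}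
    (hP : IsPathFromTo S {z | z ∈ C.support} P) (hQ : IsPathFromTo S {z | z ∈ C.support} Q)
    (hPQ : P.support.Disjoint Q.support) : C.length < 2 * k := by
  by_cases hcC : c ∈ C.support
  swap
  · exact hG.length_lt_of_isPathFromTo hk hC hS hcS hca hcb hcC hP hQ hPQ
  -- Now `c` alone is a path from `S` to `C`, which replaces `P` or `Q`.
  obtain ⟨w, hwS, hwC⟩ := hSC
  have hwc : w ≠ c := by rintro rfl; exact hwC hcC
  have hc : IsPathFromTo S {z | z ∈ C.support} (.nil : G.Walk c c) := .nil hcS hcC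
  by_cases hwa : w = a
  · have hwb : w ≠ b := by
      rintro rfl
      exact hPQ P.start_mem_support (hwa ▸ Q.start_mem_support)
    exact hG.length_lt_of_isPathFromTo hk hC hS hwS hwb hwc hwC hQ hc
      (by simpa using fun h => hcb (hQ.eq_start c h hcS))
  · exact hG.length_lt_of_isPathFromTo hk hC hS hwS hwa hwc hwC hP hc
      (by simpa using fun h => hca (hP.eq_start c h hcS))

theorem length_lt (hG : NoConsecutiveCycles G k) (hk : 3 ≤ k) (hT : BlocksHaveTriangle G)
    {C : G.Walk u u} (hC : C.IsCycle) : C.length < 3 * k := by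
  obtain ⟨e, he⟩ := List.exists_mem_of_ne_nil C.edges fun h => hC.not_nil (Walk.edges_eq_nil.1 h)
  obtain ⟨a, b, c, hab, hac, hbc, v, D, hD, heD, habD⟩ := hT e ⟨u, C, hC, he, he⟩
  by_cases hSC : ∃ w ∈ ({a, b, c} : Set V), w ∉ C.support
  swap
  · push Not at hSC
    exact hG.length_lt_of_triangle_subset hk hC hab hac hbc (hSC a (by simp)) (hSC b (by simp))
      (hSC c (by simp))
  induction e with | h x y =>
  obtain ⟨R, hR, -, -, hDR⟩ := exists_isPath_of_mem_edges hD habD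
  obtain ⟨a', p, b', q, P, Q, hP, hQ, hPQ⟩ :=
    exists_disjoint_isPathFromTo (S := {a, b, c}) (T := {z | z ∈ C.support}) hR (by simp) (by simp)
      (hDR (D.fst_mem_support_of_mem_edges heD)) (hDR (D.snd_mem_support_of_mem_edges heD))
      (C.fst_mem_support_of_mem_edges he) (C.snd_mem_support_of_mem_edges he)
      (C.adj_of_mem_edges he).ne
  have hS : G.IsClique {a, b, c} := by simp [isClique_insert, hab, hac, hbc]
  obtain ⟨c', hc', hca, hcb⟩ : ∃ c' ∈ ({a, b, c} : Set V), c' ≠ a' ∧ c' ≠ b' := by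
    have hcard : ({a', b'} : Set V).ncard < ({a, b, c} : Set V).ncard := by
      rw [Set.ncard_eq_three.2 ⟨a, b, c, hab.ne, hac.ne, hbc.ne, rfl⟩]
      exact (Set.ncard_insert_le a' {b'}).trans_lt (by simp)
    obtain ⟨c', hc', hne⟩ := Set.exists_mem_notMem_of_ncard_lt_ncard hcard
    exact ⟨c', hc', by simpa using hne⟩
  have := hG.length_lt_of_exists_notMem hk hC hS hc' hca hcb hSC hP hQ hPQ
  omega

end NoConsecutiveCycles

end ConsecutiveCycles

section SmallDegree

variable {k : ℕ} {x y : V}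

theorem two_mul_card_le_of_forall_succ_notMem {I : Finset ℕ} {a b : ℕ}
    (hI : I ⊆ Finset.Icc a b) (hsucc : ∀ i ∈ I, i + 1 ∉ I) : 2 * I.card ≤ b + 2 - a := by
  have hdisj : Disjoint I (I.map (addRightEmbedding 1)) := by
    rw [Finset.disjoint_left]
    intro i hi hi'
    obtain ⟨m, hm, rfl⟩ := Finset.mem_map.1 hi'
    exact hsucc m hm hi
  have hsub : I.disjUnion _ hdisj ⊆ Finset.Icc a (b + 1) := by
    intro i hi
    simp only [Finset.mem_disjUnion, Finset.mem_map, addRightEmbedding_apply] at hi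
    obtain h | ⟨m, h, rfl⟩ := hi <;>
    · have := Finset.mem_Icc.1 (hI h)
      exact Finset.mem_Icc.2 (by omega)
  have := Finset.card_le_card hsub
  rw [Finset.card_disjUnion, Finset.card_map, Nat.card_Icc] at this
  omega

theorem two_mul_card_lt_of_forall_succ_mem {I : Finset ℕ} {j : ℕ}
    (hI : I ⊆ Finset.Icc 1 j) (hj : j + 1 < 3 * k)
    (hsucc : ∀ i ∈ I, i + 1 ∈ I → i + 2 ≤ k ∧ j + 2 ≤ k + i) : 2 * I.card < 3 * k := by
  by_cases h : ∃ i ∈ I, i + 1 ∈ I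
  swap
  · have := two_mul_card_le_of_forall_succ_notMem hI fun i hi hi' => h ⟨i, hi, hi'⟩
    omega
  obtain ⟨i, hi, hi'⟩ := h
  have hj_lt := hsucc i hi hi'
  have := Finset.mem_Icc.1 (hI hi)
  -- Consecutive elements occur only up to `k - 2`, and `j ≤ 2 * k - 4`.
  have hlow : (I.filter (· + 2 ≤ k)).card ≤ k - 2 := by
    refine (Finset.card_le_card (t := Finset.Icc 1 (k - 2)) fun m hm => ?_).trans (by simp)
    have hm' := Finset.mem_filter.1 hm
    have := Finset.mem_Icc.1 (hI hm'.1)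
    exact Finset.mem_Icc.2 (by omega)
  have hhigh : 2 * (I.filter (¬ · + 2 ≤ k)).card ≤ j + 2 - (k - 1) := by
    refine two_mul_card_le_of_forall_succ_notMem (fun m hm => ?_) fun m hm hm' => ?_
    · have hm' := Finset.mem_filter.1 hm
      have := Finset.mem_Icc.1 (hI hm'.1)
      exact Finset.mem_Icc.2 (by omega)
    · rw [Finset.mem_filter] at hm hm'
      exact hm.2 (hsucc m hm.1 hm'.1).1
  have := Finset.card_filter_add_card_filter_not (s := I) (· + 2 ≤ k)
  omega

theorem exists_isPath_getVert {p : G.Walk x y} (hp : p.IsPath) {i j : ℕ} (hij : i ≤ j)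
    (hj : j ≤ p.length) : ∃ R : G.Walk (p.getVert i) (p.getVert j), R.IsPath ∧ R.length = j - i ∧
      ∀ m ≤ p.length, p.getVert m ∈ R.support → i ≤ m ∧ m ≤ j := by
  have hend : (p.drop i).getVert (j - i) = p.getVert j := by
    rw [Walk.drop_getVert, Nat.add_sub_cancel' hij]
  refine ⟨((p.drop i).take (j - i)).copy rfl hend, by simpa using (hp.drop i).take (j - i),
    by rw [Walk.length_copy, Walk.take_length, Walk.drop_length]; omega, fun m hm hmR => ?_⟩
  rw [Walk.support_copy] at hmR
  obtain ⟨l, hl, hlR⟩ := Walk.mem_support_iff_exists_getVert.1 hmR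
  rw [Walk.take_getVert, Walk.drop_getVert] at hl
  rw [Walk.take_length, Walk.drop_length] at hlR
  have hl_le : i + min (j - i) l ≤ p.length := by omega
  have := hp.getVert_injOn hl_le hm hl
  omega

open Classical in
/-- The indices of the vertices of the walk `p` that are adjacent to its first vertex. -/
noncomputable def neighborIndices (p : G.Walk x y) : Finset ℕ :=
  {i ∈ Finset.Icc 1 p.length | G.Adj x (p.getVert i)}

theorem mem_neighborIndices {p : G.Walk x y} {i : ℕ} :
    i ∈ neighborIndices p ↔ (1 ≤ i ∧ i ≤ p.length) ∧ G.Adj x (p.getVert i) := by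
  simp [neighborIndices]

theorem ncard_neighborSet_le_card_neighborIndices {p : G.Walk x y}
    (h : ∀ z, G.Adj x z → z ∈ p.support) :
    (G.neighborSet x).ncard ≤ (neighborIndices p).card := by
  have hsub : G.neighborSet x ⊆ p.getVert '' neighborIndices p := by
    intro z hz
    obtain ⟨i, rfl, hi⟩ := Walk.mem_support_iff_exists_getVert.1 (h z hz)
    have hi_pos : i ≠ 0 := by
      rintro rfl
      exact hz.ne p.getVert_zero.symm
    exact ⟨i, mem_neighborIndices.2 ⟨⟨by omega, hi⟩, hz⟩, rfl⟩
  calc (G.neighborSet x).ncard ≤ (p.getVert '' neighborIndices p).ncard :=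
        Set.ncard_le_ncard hsub ((Finset.finite_toSet _).image _)
    _ ≤ (neighborIndices p : Set ℕ).ncard := Set.ncard_image_le (Finset.finite_toSet _)
    _ = (neighborIndices p).card := Set.ncard_coe_finset _

theorem NoConsecutiveCycles.add_two_le_of_succ_mem (hG : NoConsecutiveCycles G k) (hk : 3 ≤ k)
    {p : G.Walk x y} (hp : p.IsPath) {i j : ℕ} (hi : i ∈ neighborIndices p)
    (hi' : i + 1 ∈ neighborIndices p) (hj : j ∈ neighborIndices p) (hij : i + 1 ≤ j) :
    i + 2 ≤ k ∧ j + 2 ≤ k + i := by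
  obtain ⟨-, hi_adj⟩ := mem_neighborIndices.1 hi
  obtain ⟨⟨-, hi_le⟩, hi'_adj⟩ := mem_neighborIndices.1 hi'
  obtain ⟨⟨-, hj_le⟩, hj_adj⟩ := mem_neighborIndices.1 hj
  have hadj : G.Adj (p.getVert i) (p.getVert (i + 1)) := p.adj_getVert_succ (by omega)
  constructor
  · obtain ⟨R, hR, hR_len, hR_mem⟩ := exists_isPath_getVert hp (Nat.zero_le i) (by omega)
    have hR' : p.getVert (i + 1) ∉ R.support := fun h => by
      have := hR_mem _ hi_le h
      omega
    have := hG.length_add_one_lt hk (by simpa using hi_adj) (by simpa using hi'_adj) hadj hR hR'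
    omega
  · obtain ⟨R, hR, hR_len, hR_mem⟩ := exists_isPath_getVert hp hij hj_le
    have hxR : x ∉ R.reverse.support := fun h => by
      have := hR_mem 0 (by omega) (by simpa using h)
      omega
    have hiR : p.getVert i ∉ (Walk.cons hj_adj R.reverse).support := fun h => by
      rcases List.mem_cons.1 h with h | h
      · exact hi_adj.ne' h
      · have := hR_mem i (by omega) (by simpa using h)
        omega
    have := hG.length_add_one_lt hk hi'_adj hi_adj hadj.symm (hR.reverse.cons hxR) hiR
    rw [Walk.length_cons, Walk.length_reverse] at this
    omega

theorem add_one_lt_of_mem_neighborIndices {N : ℕ} (hN : 3 ≤ N)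
    (hlen : ∀ ℓ ≥ N, (cycleGraph ℓ).Free G) {p : G.Walk x y} (hp : p.IsPath) {j : ℕ}
    (hj : j ∈ neighborIndices p) : j + 1 < N := by
  obtain ⟨⟨-, hj_le⟩, hj_adj⟩ := mem_neighborIndices.1 hj
  obtain ⟨R, hR, hR_len, -⟩ := exists_isPath_getVert hp (Nat.zero_le j) hj_le
  by_contra! hjN
  have hcycle := cycleGraph_isContained_of_isPath hR (by simpa using hj_adj) (by omega)
  rw [hR_len] at hcycle
  exact hlen _ hjN hcycle

theorem NoConsecutiveCycles.exists_ncard_neighborSet_le [Finite V] [Nonempty V]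
    (hG : NoConsecutiveCycles G k) (hk : 3 ≤ k) (hlen : ∀ ℓ ≥ 3 * k, (cycleGraph ℓ).Free G) :
    ∃ v, (G.neighborSet v).ncard ≤ (3 * k - 1) / 2 := by
  obtain ⟨x, y, p, hp, hmax⟩ := Walk.exists_isPath_forall_isPath_length_le_length G
  have hnbr : ∀ z, G.Adj x z → z ∈ p.support := by
    intro z hz
    by_contra hzp
    have := hmax _ _ _ (hp.cons (h := hz.symm) hzp)
    simp at this
  refine ⟨x, (ncard_neighborSet_le_card_neighborIndices hnbr).trans ?_⟩
  rcases (neighborIndices p).eq_empty_or_nonempty with hI | hI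
  · simp [hI]
  obtain ⟨j, hj, hj_max⟩ := (neighborIndices p).exists_max_image id hI
  have := two_mul_card_lt_of_forall_succ_mem
    (fun i hi => Finset.mem_Icc.2 ⟨(mem_neighborIndices.1 hi).1.1, hj_max i hi⟩)
    (add_one_lt_of_mem_neighborIndices (by omega) hlen hp hj)
    (fun i hi hi' => hG.add_two_le_of_succ_mem hk hp hi hi' hj (hj_max _ hi'))
  omega

/-- The graph `G` is `d`-degenerate: every nonempty finite set of vertices induces a subgraph
with a vertex of degree at most `d`. -/
def IsDegenerate (G : SimpleGraph V) (d : ℕ) : Prop :=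
  ∀ s : Finset V, s.Nonempty → ∃ v ∈ s, (G.neighborSet v ∩ s).ncard ≤ d

theorem IsDegenerate.ncard_edgeSet_inter_sym2_le {d : ℕ} (hG : IsDegenerate G d) (s : Finset V) :
    (G.edgeSet ∩ s.sym2).ncard ≤ d * (s.card - 1) := by
  classical
  induction s using Finset.strongInduction with | H s ih =>
  obtain rfl | hs := s.eq_empty_or_nonempty
  · simp
  obtain ⟨v, hv, hdeg⟩ := hG s hs
  obtain hs' | hs' := (s.erase v).eq_empty_or_nonempty
  · obtain rfl : s = {v} := by rw [← Finset.insert_erase hv, hs', insert_empty_eq]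
    simp
  have hsub : G.edgeSet ∩ s.sym2 ⊆
      G.edgeSet ∩ (s.erase v).sym2 ∪ (s(v, ·)) '' (G.neighborSet v ∩ s) := by
    intro e he
    induction e with | h a b =>
    simp only [Finset.coe_sym2, Set.mem_inter_iff, mem_edgeSet, Set.mk_mem_sym2_iff,
      SetLike.mem_coe] at he
    simp only [Finset.coe_sym2, Finset.coe_erase, Set.mem_union, Set.mem_inter_iff, mem_edgeSet,
      Set.mk_mem_sym2_iff, Set.mem_sdiff, SetLike.mem_coe, Set.mem_singleton_iff, Set.mem_image,
      mem_neighborSet, Sym2.eq, Sym2.rel_iff', Prod.mk.injEq, Prod.swap_prod_mk]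
    grind [SimpleGraph.adj_comm]
  have hfin : (G.edgeSet ∩ (s.erase v).sym2 ∪ (s(v, ·)) '' (G.neighborSet v ∩ s)).Finite :=
    ((Finset.finite_toSet _).inter_of_right _).union
      (((Finset.finite_toSet s).inter_of_right _).image _)
  have hcard := Finset.card_erase_of_mem hv
  calc (G.edgeSet ∩ s.sym2).ncard
      ≤ (G.edgeSet ∩ (s.erase v).sym2).ncard + ((s(v, ·)) '' (G.neighborSet v ∩ s)).ncard :=
        (Set.ncard_le_ncard hsub hfin).trans (Set.ncard_union_le _ _)
    _ ≤ d * ((s.erase v).card - 1) + d := by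
        gcongr
        · exact ih _ (Finset.erase_ssubset hv)
        · exact (Set.ncard_image_le ((Finset.finite_toSet s).inter_of_right _)).trans hdeg
    _ = d * (s.card - 1) := by
        rw [← Nat.mul_succ, ← hcard, Nat.succ_eq_add_one, Nat.sub_add_cancel hs'.card_pos]

theorem IsDegenerate.ncard_edgeSet_le [Finite V] {d : ℕ} (hG : IsDegenerate G d) :
    G.edgeSet.ncard ≤ d * (Nat.card V - 1) := by
  have := Fintype.ofFinite V
  simpa [Nat.card_eq_fintype_card] using hG.ncard_edgeSet_inter_sym2_le Finset.univ

theorem NoConsecutiveCycles.isDegenerate (hG : NoConsecutiveCycles G k) (hk : 3 ≤ k)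
    (hlen : ∀ ℓ ≥ 3 * k, (cycleGraph ℓ).Free G) : IsDegenerate G ((3 * k - 1) / 2) := by
  intro s hs
  have : Nonempty s := hs.to_subtype
  have hsG : G.induce s ⊑ G := ⟨(Embedding.induce (s : Set V)).toCopy⟩
  obtain ⟨v, hv⟩ := (hG.of_isContained hsG).exists_ncard_neighborSet_le hk
    fun ℓ hℓ h => hlen ℓ hℓ (h.trans hsG)
  refine ⟨v, v.2, ?_⟩
  rw [← Set.ncard_image_of_injective _ Subtype.val_injective] at hv
  convert hv using 2
  ext z
  simp [and_comm]

end SmallDegree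

section Bridges

variable {u v a b c x y : V} {e : Sym2 V}

theorem sup_edge_adj_self (hxy : x ≠ y) : (G ⊔ edge x y).Adj x y := by
  simp [edge_adj, hxy]

theorem mem_edgeSet_of_mem_edges_sup_edge {W : (G ⊔ edge x y).Walk u v}
    (hW : s(x, y) ∉ W.edges) : ∀ e ∈ W.edges, e ∈ G.edgeSet := by
  intro e he
  induction e with | h a b =>
  refine (W.adj_of_mem_edges he).resolve_right fun h => hW ?_
  rw [edge_adj] at h
  rcases h.1 with ⟨rfl, rfl⟩ | ⟨rfl, rfl⟩
  exacts [he, Sym2.eq_swap ▸ he]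

theorem exists_append_cons_of_mem_edges {W : G.Walk u v} (he : e ∈ W.edges) :
    ∃ (a b : V) (hab : G.Adj a b) (P : G.Walk u a) (Q : G.Walk b v),
      s(a, b) = e ∧ W = P.append (.cons hab Q) := by
  induction W with
  | nil => simp at he
  | @cons u a v hua W ih =>
    rcases List.mem_cons.1 he with rfl | he
    · exact ⟨u, a, hua, .nil, W, rfl, rfl⟩
    · obtain ⟨b, c, hbc, P, Q, hbc', rfl⟩ := ih he
      exact ⟨b, c, hbc, .cons hua P, Q, hbc', rfl⟩

theorem exists_adj_adj_of_mem_edges {W : G.Walk u v} (hW : W.IsPath) (hlen : 2 ≤ W.length)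
    (he : e ∈ W.edges) : ∃ a b c, G.Adj a b ∧ G.Adj b c ∧ a ≠ c ∧ s(a, b) = e := by
  induction e with | h x y =>
  obtain ⟨i, hi, hxy⟩ := W.mk_mem_edges_iff_exists.1 he
  have hne : ∀ j, j + 2 ≤ W.length → W.getVert j ≠ W.getVert (j + 2) := fun j hj h => by
    have hj' : j ≤ W.length := by omega
    have := hW.getVert_injOn hj' hj h
    omega
  by_cases hi' : i + 2 ≤ W.length
  · exact ⟨_, _, _, W.adj_getVert_succ hi, W.adj_getVert_succ hi', hne i hi', hxy⟩
  · obtain ⟨j, rfl⟩ : ∃ j, i = j + 1 := ⟨i - 1, by omega⟩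
    exact ⟨_, _, _, (W.adj_getVert_succ hi).symm, (W.adj_getVert_succ (by omega)).symm,
      (hne j hi).symm, Sym2.eq_swap.trans hxy⟩

/-- Every path of `G` has length at most `m`. -/
def PathLengthLE (G : SimpleGraph V) (m : ℕ) : Prop :=
  ∀ (u v : V) (p : G.Walk u v), p.IsPath → p.length ≤ m

theorem PathLengthLE.anti {m : ℕ} (hGH : G ≤ H) (hH : PathLengthLE H m) : PathLengthLE G m :=
  fun u v p hp => by simpa using hH u v _ (hp.mapLe hGH)

theorem PathLengthLE.sup_edge {m : ℕ} (hG : PathLengthLE G m) :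
    PathLengthLE (G ⊔ edge x y) (2 * m + 1) := by
  have hlen : ∀ {u v} (p : (G ⊔ edge x y).Walk u v), p.IsPath → s(x, y) ∉ p.edges →
      p.length ≤ m := fun p hp hxy => by
    simpa using hG _ _ _ (hp.transfer (mem_edgeSet_of_mem_edges_sup_edge hxy))
  intro u v p hp
  by_cases hxy : s(x, y) ∈ p.edges
  · obtain ⟨a, b, hab, P, Q, habxy, rfl⟩ := exists_append_cons_of_mem_edges hxy
    have hnodup := hp.isTrail.edges_nodup
    simp only [Walk.edges_append, Walk.edges_cons, List.nodup_append', List.nodup_cons,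
      List.disjoint_cons_right, habxy] at hnodup
    have := hlen P hp.of_append_left hnodup.2.2.1
    have := hlen Q hp.of_append_right.of_cons hnodup.2.1.1
    rw [Walk.length_append, Walk.length_cons]
    omega
  · have := hlen p hp hxy
    omega

theorem pathLengthLE_one (hG : ∀ a b c, G.Adj a b → G.Adj b c → a = c) : PathLengthLE G 1 := by
  intro u v p hp
  match p, hp with
  | .nil, _ => simp
  | .cons _ .nil, _ => simp
  | .cons huv (.cons hvw p), hp =>
    obtain rfl := hG _ _ _ huv hvw
    simp at hp

theorem PathLengthLE.of_deleteEdges {m : ℕ} (hm : 1 ≤ m) (hG : PathLengthLE (G.deleteEdges {e}) m)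
    (he : ∀ a b c, G.Adj a b → G.Adj b c → s(a, b) = e → a = c) : PathLengthLE G m := by
  intro u v p hp
  by_contra! hlen
  have hep : ∀ f ∈ p.edges, f ∉ ({e} : Set (Sym2 V)) := by
    rintro f hf rfl
    obtain ⟨a, b, c, hab, hbc, hac, habe⟩ := exists_adj_adj_of_mem_edges hp (by omega) hf
    exact hac (he a b c hab hbc habe)
  have := hG u v _ (hp.toDeleteEdges G {e} hep)
  rw [Walk.length_transfer] at this
  omega

/-- The spanning subgraph of `G` whose edges are the bridges of `G`. -/
def bridgeGraph (G : SimpleGraph V) : SimpleGraph V where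
  Adj a b := G.Adj a b ∧ G.IsBridge s(a, b)
  symm := ⟨fun _ _ h => ⟨h.1.symm, Sym2.eq_swap ▸ h.2⟩⟩
  loopless := ⟨fun _ h => h.1.ne rfl⟩

theorem bridgeGraph_le : bridgeGraph G ≤ G := fun _ _ h => h.1

theorem bridgeGraph_adj_iff_not_cyclicPair :
    (bridgeGraph G).Adj a b ↔ G.Adj a b ∧ ¬ CyclicPair G s(a, b) s(a, b) := by
  refine and_congr_right fun hab => ?_
  rw [isBridge_iff_forall_cycle_notMem hab]
  exact ⟨fun h ⟨u, C, hC, he, _⟩ => h C hC he, fun h u C hC he => h ⟨u, C, hC, he, he⟩⟩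

theorem bridgeGraph_sup_edge_le : bridgeGraph (G ⊔ edge x y) ≤ bridgeGraph G ⊔ edge x y :=
  fun _ _ h => h.1.imp_left fun hab => ⟨hab, h.2.anti le_sup_left⟩

theorem deleteEdges_bridgeGraph_sup_edge_le :
    (bridgeGraph (G ⊔ edge x y)).deleteEdges {s(x, y)} ≤ bridgeGraph G := by
  intro u v huv
  obtain ⟨huv, hne⟩ := deleteEdges_adj.1 huv
  refine (bridgeGraph_sup_edge_le huv).resolve_right fun h => hne ?_
  have hxy : x ≠ y := fun hxy => by simp [hxy] at h
  rwa [← mem_edgeSet, edgeSet_edge_of_ne hxy] at h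

theorem bridgeGraph_sup_edge_le_deleteEdges (hac : a ≠ c) (hab : G.Adj a b) (hbc : G.Adj b c) :
    bridgeGraph (G ⊔ edge a c) ≤ (bridgeGraph G).deleteEdges {s(a, b)} := by
  have hac' : (G ⊔ edge a c).Adj a c := sup_edge_adj_self hac
  have hle : G ≤ G ⊔ edge a c := le_sup_left
  have hcyc_ab := cyclicPair_of_triangle (hle hab) hac' (hle hbc)
  have hcyc_ac := cyclicPair_of_triangle hac' (hle hab) (hle hbc.symm)
  intro u v huv
  have hnot := (bridgeGraph_adj_iff_not_cyclicPair.1 huv).2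
  refine deleteEdges_adj.2 ⟨(bridgeGraph_sup_edge_le huv).resolve_right fun h => ?_, ?_⟩
  · rw [← mem_edgeSet, edgeSet_edge_of_ne hac] at h
    exact hnot (h ▸ hcyc_ac.left)
  · rintro h
    exact hnot (h ▸ hcyc_ab.left)

theorem length_eq_of_isPath_bridgeGraph {p : (bridgeGraph G).Walk u v} (hp : p.IsPath)
    {q : G.Walk u v} (hq : q.IsPath) : q.length = p.length := by
  induction p with
  | nil => simpa using hq
  | @cons a b c hab p ih =>
    obtain ⟨hp, hap⟩ := (Walk.cons_isPath_iff hab p).1 hp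
    have hmem := isBridge_iff_forall_walk_mem_edges.1 hab.2
      (q.append (p.mapLe bridgeGraph_le).reverse)
    rw [Walk.edges_append, List.mem_append] at hmem
    have hq_mem : s(a, b) ∈ q.edges := hmem.resolve_right fun h =>
      hap (p.fst_mem_support_of_mem_edges (by simpa using h))
    have hsnd := hq.eq_snd_of_mem_edges hq_mem
    cases q with
    | nil => simp at hq_mem
    | cons hab' q =>
      rw [Walk.snd_cons] at hsnd
      subst hsnd
      rw [Walk.length_cons, Walk.length_cons, ih hp hq.of_cons]

end Bridges

section Response

variable {𝓒 : Set FinGraph} {a b c x y : V} {e : Sym2 V}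

theorem CyclicPair.of_sup_edge (h : CyclicPair (G ⊔ edge x y) e e) :
    CyclicPair G e e ∨ CyclicPair (G ⊔ edge x y) e s(x, y) := by
  obtain ⟨u, C, hC, he, -⟩ := h
  by_cases hxy : s(x, y) ∈ C.edges
  · exact .inr ⟨u, C, hC, he, hxy⟩
  · have hCG := mem_edgeSet_of_mem_edges_sup_edge hxy
    exact .inl ⟨u, C.transfer G hCG, hC.transfer hCG, by simpa, by simpa⟩

theorem CyclicPair.blockHasTriangle_of_sup_edge (h : CyclicPair (G ⊔ edge x y) e e)
    (hGH : G ⊔ edge x y ≤ H) (hG : CyclicPair G e e → BlockHasTriangle H e)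
    (hxy : CyclicPair (G ⊔ edge x y) s(x, y) s(x, y) → BlockHasTriangle H s(x, y)) :
    BlockHasTriangle H e :=
  h.of_sup_edge.elim hG fun he => (he.mono hGH).blockHasTriangle (hxy he.symm.left)

theorem CyclicPair.exists_isPath_of_sup_edge
    (h : CyclicPair (G ⊔ edge x y) s(x, y) s(x, y)) : ∃ p : G.Walk x y, p.IsPath := by
  obtain ⟨u, C, hC, he, -⟩ := h
  obtain ⟨R, hR, hxyR, -, -⟩ := exists_isPath_of_mem_edges hC he
  exact ⟨_, hR.transfer (mem_edgeSet_of_mem_edges_sup_edge hxyR)⟩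

theorem BlocksHaveTriangle.sup_edge (hG : BlocksHaveTriangle G) (hxy : x ≠ y)
    (hadj : ¬ G.Adj x y) (hbridge : ∀ p : (bridgeGraph G).Walk x y, p.IsPath → p.length ≤ 2) :
    BlocksHaveTriangle (G ⊔ edge x y) := by
  have hle : G ≤ G ⊔ edge x y := le_sup_left
  have hxy' := sup_edge_adj_self (G := G) hxy
  intro e he
  refine he.blockHasTriangle_of_sup_edge le_rfl (fun h => (hG e h).mono hle) fun hcyc => ?_
  obtain ⟨p, hp⟩ := hcyc.exists_isPath_of_sup_edge
  by_cases hp_cyc : ∃ f ∈ p.edges, CyclicPair G f f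
  · obtain ⟨f, hf, hfG⟩ := hp_cyc
    have hne : f ≠ s(x, y) := by
      rintro rfl
      exact hadj (p.adj_of_mem_edges hf)
    exact (cyclicPair_of_isPath (hp.mapLe hle) hxy' (by simpa) hne).blockHasTriangle
      ((hG f hfG).mono hle)
  · push Not at hp_cyc
    have hpB : ∀ f ∈ p.edges, f ∈ (bridgeGraph G).edgeSet := by
      intro f hf
      induction f with | h a b =>
      exact bridgeGraph_adj_iff_not_cyclicPair.2 ⟨p.adj_of_mem_edges hf, hp_cyc _ hf⟩
    have hlen := hbridge _ (hp.transfer hpB)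
    rw [Walk.length_transfer] at hlen
    match p, hlen with
    | .nil, _ => exact (hxy rfl).elim
    | .cons hxy .nil, _ => exact (hadj hxy).elim
    | .cons (v := z) hxz (.cons hzy .nil), _ =>
      exact blockHasTriangle_of_triangle hxy' (hle hxz) (hle hzy.symm)

theorem IsCycleFamily.familyFree_iff (h𝓒 : IsCycleFamily 𝓒) :
    FamilyFree 𝓒 G ↔ ∀ (u : V) (C : G.Walk u u), C.IsCycle → cyc C.length ∉ 𝓒 := by
  refine ⟨fun hG u C hC hmem => hG _ hmem ?_, fun hG F hF hFG => ?_⟩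
  · exact (cycleGraph_isContained_iff (n := C.length) hC.three_le_length).2 ⟨u, C, hC, rfl⟩
  · obtain ⟨ℓ, hℓ, rfl⟩ := h𝓒 F hF
    obtain ⟨u, C, hC, rfl⟩ := (cycleGraph_isContained_iff (n := ℓ) hℓ).1 hFG
    exact hG u C hC hF

theorem IsCycleFamily.legalMove (h𝓒 : IsCycleFamily 𝓒) (h3 : cyc 3 ∉ 𝓒)
    (hG : FamilyFree 𝓒 G) (hac : a ≠ c) (hlen : ∀ q : G.Walk a c, q.IsPath → q.length = 2) :
    LegalMove 𝓒 G (G ⊔ edge a c) := by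
  refine ⟨a, c, hac, fun h => ?_, rfl, h𝓒.familyFree_iff.2 fun u C hC => ?_⟩
  · simpa using hlen h.toWalk h.isPath_toWalk
  by_cases he : s(a, c) ∈ C.edges
  · obtain ⟨R, hR, hacR, hRC, -⟩ := exists_isPath_of_mem_edges hC he
    have := hlen _ (hR.transfer (mem_edgeSet_of_mem_edges_sup_edge hacR))
    rw [Walk.length_transfer] at this
    rwa [← hRC, this]
  · have := h𝓒.familyFree_iff.1 hG u _ (hC.transfer (mem_edgeSet_of_mem_edges_sup_edge he))
    rwa [Walk.length_transfer] at this

theorem IsCycleFamily.exists_legalMove_of_adjacent_bridges (h𝓒 : IsCycleFamily 𝓒)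
    (h3 : cyc 3 ∉ 𝓒) (hG : FamilyFree 𝓒 G) (hT : BlocksHaveTriangle G) (hac : a ≠ c)
    (hab : (bridgeGraph G).Adj a b) (hbc : (bridgeGraph G).Adj b c) :
    ∃ K, LegalMove 𝓒 G K ∧ BlocksHaveTriangle K ∧
      bridgeGraph K ≤ (bridgeGraph G).deleteEdges {s(a, b)} := by
  have hlen : ∀ q : G.Walk a c, q.IsPath → q.length = 2 := fun q hq => by
    have hW : (Walk.cons hab (.cons hbc .nil)).IsPath := by
      simp [Walk.isPath_def, hab.ne, hbc.ne, hac]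
    exact length_eq_of_isPath_bridgeGraph hW hq
  have hac_nadj : ¬ G.Adj a c := fun h => by simpa using hlen h.toWalk h.isPath_toWalk
  refine ⟨_, h𝓒.legalMove h3 hG hac hlen, hT.sup_edge hac hac_nadj fun p hp => ?_,
    bridgeGraph_sup_edge_le_deleteEdges hac (bridgeGraph_le hab) (bridgeGraph_le hbc)⟩
  simpa using (hlen _ (hp.mapLe bridgeGraph_le)).le

theorem length_eq_two_of_isPath_sup_edge (hxb : x ≠ b) (hxa : (bridgeGraph G).Adj x a)
    (hab : (bridgeGraph G).Adj a b) (hby : (bridgeGraph G).Adj b y)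
    {q : (G ⊔ edge x y).Walk x b} (hq : q.IsPath) : q.length = 2 := by
  by_cases hxy : s(x, y) ∈ q.edges
  · have hsnd := hq.eq_snd_of_mem_edges hxy
    cases q with
    | nil => simp at hxy
    | cons h q =>
      rw [Walk.snd_cons] at hsnd
      subst hsnd
      obtain ⟨hq, hxq⟩ := (Walk.cons_isPath_iff h q).1 hq
      have hqG := mem_edgeSet_of_mem_edges_sup_edge fun h => hxq (q.fst_mem_support_of_mem_edges h)
      have := length_eq_of_isPath_bridgeGraph hby.symm.isPath_toWalk (hq.transfer hqG)
      simpa using this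
  · have hW : (Walk.cons hxa (.cons hab .nil)).IsPath := by
      simp [Walk.isPath_def, hxa.ne, hab.ne, hxb]
    have := length_eq_of_isPath_bridgeGraph hW
      (hq.transfer (mem_edgeSet_of_mem_edges_sup_edge hxy))
    simpa using this

theorem IsCycleFamily.exists_legalMove_of_three_bridges (h𝓒 : IsCycleFamily 𝓒)
    (h3 : cyc 3 ∉ 𝓒) (hT : BlocksHaveTriangle G) (hxy : x ≠ y)
    (hH : FamilyFree 𝓒 (G ⊔ edge x y)) (hxb : x ≠ b) (hxa : (bridgeGraph G).Adj x a)
    (hab : (bridgeGraph G).Adj a b) (hby : (bridgeGraph G).Adj b y) :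
    ∃ K, LegalMove 𝓒 (G ⊔ edge x y) K ∧ BlocksHaveTriangle K ∧ bridgeGraph K ≤ bridgeGraph G := by
  have hHK : G ⊔ edge x y ≤ G ⊔ edge x y ⊔ edge x b := le_sup_left
  have hH_xy : (G ⊔ edge x y).Adj x y := sup_edge_adj_self hxy
  have hH_yb : (G ⊔ edge x y).Adj y b := .inl (bridgeGraph_le hby.symm)
  have hK_xb : (G ⊔ edge x y ⊔ edge x b).Adj x b := sup_edge_adj_self hxb
  refine ⟨_, h𝓒.legalMove h3 hH hxb fun q => length_eq_two_of_isPath_sup_edge hxb hxa hab hby,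
    fun e he => ?_, ?_⟩
  · refine he.blockHasTriangle_of_sup_edge le_rfl (fun he' =>
      he'.blockHasTriangle_of_sup_edge hHK (fun h => (hT e h).mono (le_sup_left.trans hHK))
        fun _ => ?_) fun _ => ?_
    · exact blockHasTriangle_of_triangle (hHK hH_xy) hK_xb (hHK hH_yb)
    · exact blockHasTriangle_of_triangle hK_xb (hHK hH_xy) (hHK hH_yb.symm)
  · exact (bridgeGraph_sup_edge_le_deleteEdges hxb hH_xy hH_yb).trans
      deleteEdges_bridgeGraph_sup_edge_le

/-- The positions which Mini maintains: every block with a cycle contains a triangle, and no path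
consists of four bridges. -/
structure IsSafe (G : SimpleGraph V) : Prop where
  blocksHaveTriangle : BlocksHaveTriangle G
  pathLengthLE : PathLengthLE (bridgeGraph G) 3

theorem IsCycleFamily.exists_safe_response_of_long_path (h𝓒 : IsCycleFamily 𝓒)
    (h3 : cyc 3 ∉ 𝓒) (hG : IsSafe G) (hH : FamilyFree 𝓒 (G ⊔ edge x y))
    {p : (bridgeGraph G).Walk x y} (hp : p.IsPath) (hlen : 2 < p.length) :
    ∃ K, LegalMove 𝓒 (G ⊔ edge x y) K ∧ IsSafe K := by
  have hlen' : p.length = 3 := (hG.pathLengthLE x y p hp).antisymm hlen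
  match p, hlen' with
  | .cons (v := a) hxa (.cons (v := b) hab (.cons hby .nil)), _ =>
    obtain ⟨hxb, hxy⟩ : x ≠ b ∧ x ≠ y := by
      have := ((Walk.cons_isPath_iff _ _).1 hp).2
      simp_all
    obtain ⟨K, hHK, hKT, hKB⟩ :=
      h𝓒.exists_legalMove_of_three_bridges h3 hG.blocksHaveTriangle hxy hH hxb hxa hab hby
    exact ⟨K, hHK, hKT, hG.pathLengthLE.anti hKB⟩

theorem IsCycleFamily.exists_safe_response_of_adjacent_bridges (h𝓒 : IsCycleFamily 𝓒)
    (h3 : cyc 3 ∉ 𝓒) (hG : PathLengthLE (bridgeGraph G) 3) (hH : FamilyFree 𝓒 (G ⊔ edge x y))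
    (hT : BlocksHaveTriangle (G ⊔ edge x y)) (hac : a ≠ c)
    (hab : (bridgeGraph (G ⊔ edge x y)).Adj a b) (hbc : (bridgeGraph (G ⊔ edge x y)).Adj b c) :
    ∃ K, LegalMove 𝓒 (G ⊔ edge x y) K ∧ IsSafe K := by
  have hdelete : PathLengthLE ((bridgeGraph (G ⊔ edge x y)).deleteEdges {s(x, y)}) 3 :=
    hG.anti deleteEdges_bridgeGraph_sup_edge_le
  by_cases hnew : ∃ a b c, (bridgeGraph (G ⊔ edge x y)).Adj a b ∧
      (bridgeGraph (G ⊔ edge x y)).Adj b c ∧ s(a, b) = s(x, y) ∧ a ≠ c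
  · obtain ⟨a, b, c, hab, hbc, habxy, hac⟩ := hnew
    obtain ⟨K, hHK, hKT, hKB⟩ :=
      h𝓒.exists_legalMove_of_adjacent_bridges h3 hH hT hac hab hbc
    exact ⟨K, hHK, hKT, hdelete.anti (habxy ▸ hKB)⟩
  · push Not at hnew
    obtain ⟨K, hHK, hKT, hKB⟩ :=
      h𝓒.exists_legalMove_of_adjacent_bridges h3 hH hT hac hab hbc
    exact ⟨K, hHK, hKT,
      (hdelete.of_deleteEdges (by norm_num) hnew).anti (hKB.trans (deleteEdges_le _))⟩

theorem BlocksHaveTriangle.isSafe_of_legalMove (hT : BlocksHaveTriangle G)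
    (hG : ∀ a b c, (bridgeGraph G).Adj a b → (bridgeGraph G).Adj b c → a = c)
    (hGH : LegalMove 𝓒 G H) : IsSafe H := by
  obtain ⟨u, v, huv, hadj, rfl, -⟩ := hGH
  have hB := pathLengthLE_one hG
  exact ⟨hT.sup_edge huv hadj fun p hp => (hB u v p hp).trans one_le_two,
    hB.sup_edge.anti bridgeGraph_sup_edge_le⟩

theorem IsCycleFamily.exists_safe_response (h𝓒 : IsCycleFamily 𝓒) (h3 : cyc 3 ∉ 𝓒)
    (hG : IsSafe G) (hGH : LegalMove 𝓒 G H) :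
    (∃ K, LegalMove 𝓒 H K ∧ IsSafe K) ∨ (¬ ∃ K, LegalMove 𝓒 H K) ∧ BlocksHaveTriangle H := by
  obtain ⟨x, y, hxy, hadj, rfl, hH⟩ := hGH
  by_cases hpath : ∃ p : (bridgeGraph G).Walk x y, p.IsPath ∧ 2 < p.length
  · obtain ⟨p, hp, hlen⟩ := hpath
    exact .inl (h𝓒.exists_safe_response_of_long_path h3 hG hH hp hlen)
  push Not at hpath
  have hT := hG.blocksHaveTriangle.sup_edge hxy hadj hpath
  by_cases hadjacent : ∃ a b c, (bridgeGraph (G ⊔ edge x y)).Adj a b ∧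
      (bridgeGraph (G ⊔ edge x y)).Adj b c ∧ a ≠ c
  · obtain ⟨a, b, c, hab, hbc, hac⟩ := hadjacent
    exact .inl (h𝓒.exists_safe_response_of_adjacent_bridges h3 hG.pathLengthLE hH hT hac hab hbc)
  push Not at hadjacent
  by_cases hmove : ∃ K, LegalMove 𝓒 (G ⊔ edge x y) K
  · obtain ⟨K, hK⟩ := hmove
    exact .inl ⟨K, hK, hT.isSafe_of_legalMove hadjacent hK⟩
  · exact .inr ⟨hmove, hT⟩

end Response

section Game

variable {𝓕 : Set FinGraph}

theorem LegalMove.familyFree (h : LegalMove 𝓕 G H) : FamilyFree 𝓕 H := by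
  obtain ⟨_, _, _, _, _, hH⟩ := h
  exact hH

theorem gameValue_of_terminal [Finite V] (p : Player) (hG : ¬ ∃ H, LegalMove 𝓕 G H) :
    gameValue 𝓕 p G = G.edgeSet.ncard := by
  rw [gameValue.eq_def, if_neg hG]

theorem gameValue_mx_le [Finite V] {N : ℕ} (hG : ∃ H, LegalMove 𝓕 G H)
    (hN : ∀ H, LegalMove 𝓕 G H → gameValue 𝓕 .mini H ≤ N) : gameValue 𝓕 .mx G ≤ N := by
  rw [gameValue, if_pos hG]
  exact ciSup_le' fun H => hN H.1 H.2

theorem gameValue_mini_le [Finite V] (hGH : LegalMove 𝓕 G H) :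
    gameValue 𝓕 .mini G ≤ gameValue 𝓕 .mx H := by
  rw [gameValue.eq_def 𝓕 .mini G, if_pos ⟨H, hGH⟩]
  exact ciInf_le (OrderBot.bddBelow _) (⟨H, hGH⟩ : {H : SimpleGraph V // LegalMove 𝓕 G H})

theorem gameValue_mx_le_of_strategy [Finite V] {N : ℕ} {P : SimpleGraph V → Prop}
    (hterminal : ∀ G, P G → (¬ ∃ H, LegalMove 𝓕 G H) → G.edgeSet.ncard ≤ N)
    (hresponse : ∀ G H, P G → LegalMove 𝓕 G H → (∃ K, LegalMove 𝓕 H K ∧ P K) ∨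
      (¬ ∃ K, LegalMove 𝓕 H K) ∧ H.edgeSet.ncard ≤ N) (hG : P G) : gameValue 𝓕 .mx G ≤ N := by
  induction G using WellFoundedGT.induction with | _ G ih
  by_cases hmove : ∃ H, LegalMove 𝓕 G H
  · refine gameValue_mx_le hmove fun H hGH => ?_
    obtain ⟨K, hHK, hK⟩ | ⟨hH, hN⟩ := hresponse G H hG hGH
    · exact (gameValue_mini_le hHK).trans (ih K (hGH.lt.trans hHK.lt) hK)
    · exact (gameValue_of_terminal _ hH).trans_le hN
  · exact (gameValue_of_terminal _ hmove).trans_le (hterminal G hG hmove)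

theorem FamilyFree.noConsecutiveCycles {k : ℕ} (hG : FamilyFree 𝓕 G)
    (hdense : ∀ ℓ : ℕ, k ≤ ℓ → cyc ℓ ∈ 𝓕 ∨ cyc (ℓ + 1) ∈ 𝓕) : NoConsecutiveCycles G k :=
  fun ℓ hℓ hcycle => (hdense ℓ hℓ).elim (fun h => (hG _ h hcycle).elim) fun h => hG _ h

theorem NoConsecutiveCycles.ncard_edgeSet_le [Finite V] {k : ℕ} (hG : NoConsecutiveCycles G k)
    (hk : 3 ≤ k) (hT : BlocksHaveTriangle G) :
    G.edgeSet.ncard ≤ (3 * k - 1) / 2 * (Nat.card V - 1) := by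
  refine (hG.isDegenerate hk fun ℓ hℓ hcycle => ?_).ncard_edgeSet_le
  obtain ⟨u, C, hC, rfl⟩ := (cycleGraph_isContained_iff (n := ℓ) (by omega)).1 hcycle
  exact hℓ.not_gt (hG.length_lt hk hT hC)

theorem IsCycleFamily.familyFree_bot (h𝓕 : IsCycleFamily 𝓕) :
    FamilyFree 𝓕 (⊥ : SimpleGraph V) :=
  h𝓕.familyFree_iff.2 fun _ _ hC => (hC.isCircuit.ne_bot rfl).elim

theorem isSafe_bot : IsSafe (⊥ : SimpleGraph V) where
  blocksHaveTriangle := fun _ ⟨_, _, hC, _⟩ => (hC.isCircuit.ne_bot rfl).elim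
  pathLengthLE := fun _ _ p _ => by
    cases p with
    | nil => simp
    | cons h _ => exact h.1.elim

theorem IsCycleFamily.gameValue_mx_le [Finite V] (h𝓕 : IsCycleFamily 𝓕) (h3 : cyc 3 ∉ 𝓕) {N : ℕ}
    (hN : ∀ G : SimpleGraph V, FamilyFree 𝓕 G → BlocksHaveTriangle G → G.edgeSet.ncard ≤ N)
    (hG : FamilyFree 𝓕 G) (hsafe : IsSafe G) : gameValue 𝓕 .mx G ≤ N := by
  refine gameValue_mx_le_of_strategy (P := fun G => FamilyFree 𝓕 G ∧ IsSafe G)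
    (fun G hG _ => hN G hG.1 hG.2.blocksHaveTriangle) (fun G H hG hGH => ?_) ⟨hG, hsafe⟩
  exact (h𝓕.exists_safe_response h3 hG.2 hGH).imp
    (fun ⟨K, hHK, hK⟩ => ⟨K, hHK, hHK.familyFree, hK⟩)
    (And.imp_right (hN H hGH.familyFree))

end Game

theorem theorem1p3 (𝓒 : Set FinGraph) (h𝓒 : IsCycleFamily 𝓒) (h3 : cyc 3 ∉ 𝓒)
    (k : ℕ) (hk : 3 ≤ k) (hdense : ∀ ℓ : ℕ, k ≤ ℓ → cyc ℓ ∈ 𝓒 ∨ cyc (ℓ + 1) ∈ 𝓒)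
    (n : ℕ) (hn : 1 ≤ n) :
    (satGame n 𝓒 : ℝ) ≤ 1 / 2 * (3 * (k : ℝ) - 1) * ((n : ℝ) - 1) := by
  have hsat : satGame n 𝓒 ≤ (3 * k - 1) / 2 * (n - 1) :=
    h𝓒.gameValue_mx_le h3 (fun G hG hT => by
      simpa using (hG.noConsecutiveCycles hdense).ncard_edgeSet_le hk hT)
      h𝓒.familyFree_bot isSafe_bot
  have hfloor : (((3 * k - 1) / 2 : ℕ) : ℝ) ≤ 1 / 2 * (3 * (k : ℝ) - 1) := by
    refine Nat.cast_div_le.trans_eq ?_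
    push_cast [show 1 ≤ 3 * k by omega]
    ring
  calc (satGame n 𝓒 : ℝ) ≤ ((3 * k - 1) / 2 : ℕ) * ((n - 1 : ℕ) : ℝ) := by exact_mod_cast hsat
    _ ≤ 1 / 2 * (3 * (k : ℝ) - 1) * ((n - 1 : ℕ) : ℝ) := by gcongr
    _ = 1 / 2 * (3 * (k : ℝ) - 1) * ((n : ℝ) - 1) := by rw [Nat.cast_pred hn]
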